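/- Let $\Delta$ be a natural number. A finite simple graph $G=(V,E)$ is called $\Delta$-matched if its edges are those of a tree $T$ with vertex set $V$, rooted at a vertex $r\in V$, in which every vertex has at most $\Delta-1$ children, together with those of a perfect matching $M$ on the leaves of $T$ (the vertices without children), and $G$ has a planar drawing $\Gamma$ (vertices are distinct points of the plane, edges are Jordan arcs joining their endvertices, passing through no other vertex and pairwise disjoint except at common endvertices) such that: (1) all leaves of $T$ lie on the horizontal line $L: y=0$; (2) all edges of $T$ are drawn above $L$ and all edges of $M$ below $L$ (except for the endpoints that lie on $L$); (3) $r$ lies on the boundary of the outer (unbounded) face of $\Gamma$; (4) for every $\ell>0$, the vertices of layer $\ell$ lie on the line $y=\ell$, where the layer of $v$ is the height of $T$ minus the distance of $v$ from $r$ in $T$. A queue layout of $G$ with $k$ queues is a linear order $\prec$ of $V$ together with a partition of $E$ into $k$ (possibly empty) queues such that no queue contains two edges $(u_1,v_1)$, $(u_2,v_2)$ with $u_1\prec u_2\prec v_2\prec v_1$. The queue number of $G$ is the minimum $k$ for which $G$ has a queue layout with $k$ queues. Every $\Delta$-matched graph has queue number at most $2\Delta-2$. -/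

import Mathlib

/-! Queue layouts -/

/-- A queue layout of `G` with (at most) `k` queues: a linear order of the vertices together with
an assignment of every edge to one of `k` queues such that no two edges of the same queue are
nested. The strict inequalities `u₁ < u₂ < v₂ < v₁` force nested edges to be independent. -/
structure QueueLayout {V : Type*} (G : SimpleGraph V) (k : ℕ) where
  order : LinearOrder V
  queue : G.edgeSet → Fin k
  not_nested : ∀ (u₁ v₁ u₂ v₂ : V) (h₁ : s(u₁, v₁) ∈ G.edgeSet) (h₂ : s(u₂, v₂) ∈ G.edgeSet),
    order.lt u₁ u₂ → order.lt u₂ v₂ → order.lt v₂ v₁ →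
      queue ⟨s(u₁, v₁), h₁⟩ ≠ queue ⟨s(u₂, v₂), h₂⟩

/-- The queue number: the least number of queues in a queue layout of `G`
(`⊤` if there is no layout with finitely many queues). -/
noncomputable def queueNumber {V : Type*} (G : SimpleGraph V) : ℕ∞ :=
  ⨅ (k : ℕ) (_ : Nonempty (QueueLayout G k)), (k : ℕ∞)

/-! Drawings in the plane; the plane is `ℂ`, with horizontal coordinate `re` and vertical
coordinate `im` -/

/-- A drawing of `G`: vertices are distinct points, every edge is a Jordan arc (an injective path)
joining its endvertices and passing through no other vertex. The arc of an edge is given in both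
directions, as one path and its reverse. -/
structure GraphDrawing {V : Type*} (G : SimpleGraph V) where
  pos : V → ℂ
  pos_injective : Function.Injective pos
  arc : ∀ u v : V, G.Adj u v → Path (pos u) (pos v)
  arc_symm : ∀ (u v : V) (h : G.Adj u v), arc v u h.symm = (arc u v h).symm
  arc_injective : ∀ (u v : V) (h : G.Adj u v), Function.Injective (arc u v h)
  arc_avoids : ∀ (u v : V) (h : G.Adj u v) (w : V), pos w ∈ Set.range (arc u v h) →
    w = u ∨ w = v

namespace GraphDrawing

/-- A drawing is planar if two distinct edges meet only in common endvertices. -/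
def IsPlanar {V : Type*} {G : SimpleGraph V} (D : GraphDrawing G) : Prop :=
  ∀ (u v u' v' : V) (h : G.Adj u v) (h' : G.Adj u' v'), s(u, v) ≠ s(u', v') →
    ∀ z ∈ Set.range (D.arc u v h) ∩ Set.range (D.arc u' v' h'),
      ∃ w : V, (w = u ∨ w = v) ∧ (w = u' ∨ w = v') ∧ z = D.pos w

/-- The set of all points of the plane that are used by the drawing. -/
def support {V : Type*} {G : SimpleGraph V} (D : GraphDrawing G) : Set ℂ :=
  Set.range D.pos ∪ ⋃ (u : V) (v : V) (h : G.Adj u v), Set.range (D.arc u v h)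

/-- The outer face: the points whose connected component in the complement of the drawing
is unbounded. -/
def outerFace {V : Type*} {G : SimpleGraph V} (D : GraphDrawing G) : Set ℂ :=
  {z | z ∈ D.supportᶜ ∧ ¬ Bornology.IsBounded (connectedComponentIn D.supportᶜ z)}

end GraphDrawing

/-! Rooted trees -/

/-- The children of `u` in the tree `T` rooted at `r`. -/
def treeChildren {V : Type*} (T : SimpleGraph V) (r u : V) : Set V :=
  {v | T.Adj u v ∧ T.dist r v = T.dist r u + 1}

/-- The leaves of the tree `T` rooted at `r`: the vertices without children. -/
def treeLeaves {V : Type*} (T : SimpleGraph V) (r : V) : Set V :=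
  {u | treeChildren T r u = ∅}

/-- `T` is a tree in which, with respect to the root `r`, every vertex has at most `k` children. -/
def IsAryTree {V : Type*} (k : ℕ) (T : SimpleGraph V) (r : V) : Prop :=
  T.IsTree ∧ ∀ u : V, (treeChildren T r u).encard ≤ k

/-- The height of the tree `T` rooted at `r`. -/
noncomputable def treeHeight {V : Type*} [Fintype V] (T : SimpleGraph V) (r : V) : ℕ :=
  Finset.univ.sup (fun v : V => T.dist r v)

/-- The layer of `v`: the height of the tree minus the distance of `v` from the root. -/
noncomputable def treeLayer {V : Type*} [Fintype V] (T : SimpleGraph V) (r v : V) : ℕ :=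
  treeHeight T r - T.dist r v

/-- `G` is a `Δ`-matched graph: it consists of a spanning `(Δ - 1)`-ary tree `T` rooted at `r` and
a perfect matching `M` on the leaves of `T`, and it has a planar drawing `D` in which the leaves lie
on the line `y = 0`, the edges of `T` are above and those of `M` below this line, the root is on
the outer face, and the vertices of every layer `l > 0` lie on the line `y = l`.
(There are no such graphs for `Δ ≤ 2`, so the subtraction `Δ - 1` is harmless.) -/
def IsMatchedGraph {V : Type*} [Fintype V] (Δ : ℕ) (G : SimpleGraph V) : Prop :=
  ∃ (T : SimpleGraph V) (r : V) (M : G.Subgraph) (D : GraphDrawing G),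
    IsAryTree (Δ - 1) T r ∧
    M.IsMatching ∧ M.verts = treeLeaves T r ∧
    G = T ⊔ M.spanningCoe ∧
    D.IsPlanar ∧
    (∀ v ∈ treeLeaves T r, (D.pos v).im = 0) ∧
    (∀ (u v : V) (h : G.Adj u v), T.Adj u v → ∀ t ∈ Set.Ioo (0 : unitInterval) 1,
      0 < (D.arc u v h t).im) ∧
    (∀ (u v : V) (h : G.Adj u v), M.Adj u v → ∀ t ∈ Set.Ioo (0 : unitInterval) 1,
      (D.arc u v h t).im < 0) ∧
    D.pos r ∈ frontier D.outerFace ∧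
    (∀ v : V, 0 < treeLayer T r v → (D.pos v).im = treeLayer T r v)

/-! Put D = Δ - 1. The layer condition forces all leaves of T to the same depth. From the drawing
only two facts about the leaves on L are needed: matching edges do not cross, and the leaves of a
subtree do not interleave with the remaining leaves. Both follow from
`Path.exists_eq_of_interleaved`, a winding number argument in a half plane. The second fact only
makes each subtree an interval of the cyclic order of the leaves, but this order can be cut so that
all subtrees become genuine intervals (`exists_rotation_ordConnected`); noncrossing is a cyclic
property and survives.

The nesting of a leaf is the number of matching edges over it. Partners have equal nesting, and
leaves strictly under an edge have larger nesting than its ends, so ordering leaves by nesting and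
then from left to right puts all of M in one queue.

For a vertex v at height h above the leaves, let s(v) be the minimal nesting of the leaves below v
divided by D^h, rounded down. Moving past one leaf changes the nesting by at most 1, and the
siblings of a child c have few leaves, so s(c) - D s(u) lies in {0, ..., 2D - 2} for the parent u
(`scaledNesting_child`). Order the vertices by depth, then s, then leftmost leaf. Among tree edges
with a fixed difference, children are ordered as their parents are, so none nest. This gives 2D - 1
queues for T and one for M, in total 2D = 2Δ - 2. -/

/-! ### Winding numbers and crossing paths in a half plane -/

open scoped unitInterval in
theorem constant_of_exp_constant {φ : I → ℂ} (hφ : Continuous φ) {c : ℂ}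
    (h : ∀ s, Complex.exp (φ s) = c) : φ 0 = φ 1 := by
  have hc : c ≠ 0 := h 0 ▸ Complex.exp_ne_zero _
  have key : (φ : I → ℂ) = fun _ => φ 0 :=
    Complex.isCoveringMap_exp.eq_of_comp_eq hφ continuous_const
      (by ext s; simp [h]) 0 rfl
  exact (congrFun key 1).symm

open scoped unitInterval in
/-- The change of a logarithm `g` of `h` along a path whose rotation by `w` stays in the closed
right half plane. -/
theorem log_change_of_re_nonneg {g h : I → ℂ} (hg : Continuous g) (hh : Continuous h)
    (hgh : ∀ s, Complex.exp (g s) = h s) {w : ℂ} (hw : w ≠ 0) (hre : ∀ s, 0 ≤ (w * h s).re) :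
    g 1 - g 0 = Complex.log (w * h 1) - Complex.log (w * h 0) := by
  have hne : ∀ s, w * h s ≠ 0 := fun s => mul_ne_zero hw (hgh s ▸ Complex.exp_ne_zero _)
  -- The closed right half plane without 0 misses the branch cut of the principal logarithm.
  have hslit : ∀ s, w * h s ∈ Complex.slitPlane := by
    intro s
    rw [Complex.mem_slitPlane_iff]
    by_contra! hcon
    exact hne s (Complex.ext (le_antisymm hcon.1 (hre s)) hcon.2)
  have hcont : Continuous fun s => g s - Complex.log (w * h s) :=
    hg.sub (Continuous.clog (continuous_const.mul hh) hslit)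
  have := constant_of_exp_constant hcont (c := w⁻¹) (fun s => by
    have := Complex.exp_ne_zero (g s)
    rw [Complex.exp_sub, Complex.exp_log (hne s), ← hgh s]
    field_simp)
  linear_combination -this

-- The exponential is a covering of the punctured plane: lift one side of the square, then the whole
-- square by homotopy lifting.
open scoped unitInterval in
theorem exists_log_on_square {f : I × I → ℂ} (hf : Continuous f) (h0 : ∀ p, f p ≠ 0) :
    ∃ g : I × I → ℂ, Continuous g ∧ ∀ p, Complex.exp (g p) = f p := by
  let F : C(I × I, {z : ℂ // z ≠ 0}) := ⟨fun p => ⟨f p, h0 p⟩, by fun_prop⟩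
  let F0 : C(I, {z : ℂ // z ≠ 0}) := ⟨fun s => F (0, s), by fun_prop⟩
  obtain ⟨g0, hg0, -⟩ := Complex.isCoveringMap_exp.exists_path_lifts F0 (Complex.log (f (0, 0)))
    (Subtype.ext (Complex.exp_log (h0 _)).symm)
  have H0 : ∀ a, F (0, a) = ⟨Complex.exp (g0 a), Complex.exp_ne_zero _⟩ :=
    fun a => (congrFun hg0 a).symm
  refine ⟨Complex.isCoveringMap_exp.liftHomotopy F g0 H0, ContinuousMap.continuous _, fun p => ?_⟩
  exact congrArg Subtype.val (congrFun (Complex.isCoveringMap_exp.liftHomotopy_lifts F g0 H0) p)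

theorem log_neg_I_mul_ofReal_pos {x : ℝ} (hx : 0 < x) :
    (Complex.log (-Complex.I * x)).im = -(Real.pi / 2) := by
  rw [Complex.log_im, mul_comm, Complex.arg_real_mul _ hx, Complex.arg_neg_I]

theorem log_I_mul_ofReal_pos {x : ℝ} (hx : 0 < x) :
    (Complex.log (Complex.I * x)).im = Real.pi / 2 := by
  rw [Complex.log_im, mul_comm, Complex.arg_real_mul _ hx, Complex.arg_I]

theorem log_neg_I_mul_ofReal_neg {x : ℝ} (hx : x < 0) :
    (Complex.log (-Complex.I * x)).im = Real.pi / 2 := by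
  rw [← log_I_mul_ofReal_pos (neg_pos.2 hx)]; push_cast; ring_nf

theorem log_I_mul_ofReal_neg {x : ℝ} (hx : x < 0) :
    (Complex.log (Complex.I * x)).im = -(Real.pi / 2) := by
  rw [← log_neg_I_mul_ofReal_pos (neg_pos.2 hx)]; push_cast; ring_nf

/-- Two paths in the closed upper half plane whose endpoints interleave on the real line meet. -/
theorem Path.exists_eq_of_interleaved {a b c d : ℝ} (hab : a < b) (hbc : b < c) (hcd : c < d)
    (γ : Path (a : ℂ) c) (δ : Path (b : ℂ) d) (hγ : ∀ s, 0 ≤ (γ s).im) (hδ : ∀ s, 0 ≤ (δ s).im) :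
    ∃ s t, γ s = δ t := by
  by_contra! hne
  obtain ⟨g, hg, hgf⟩ := exists_log_on_square (f := fun p => γ p.1 - δ p.2) (by fun_prop)
    (fun p => sub_ne_zero.2 (hne _ _))
  have hI : -Complex.I ≠ 0 := neg_ne_zero.2 Complex.I_ne_zero
  -- On each side of the square one path rests at a real point, so the difference stays in the
  -- closed upper half plane when γ moves and in the lower one when δ moves. The factors -i and i
  -- turn these into the right half plane.
  have e1 := log_change_of_re_nonneg (g := fun s => g (s, 0)) (h := fun s => γ s - δ 0)
    (by fun_prop) (by fun_prop) (fun s => hgf _) hI (fun s => by simpa using hγ s)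
  have e2 := log_change_of_re_nonneg (g := fun s => g (s, 1)) (h := fun s => γ s - δ 1)
    (by fun_prop) (by fun_prop) (fun s => hgf _) hI (fun s => by simpa using hγ s)
  have e3 := log_change_of_re_nonneg (g := fun s => g (0, s)) (h := fun s => γ 0 - δ s)
    (by fun_prop) (by fun_prop) (fun s => hgf _) Complex.I_ne_zero (fun s => by simpa using hδ s)
  have e4 := log_change_of_re_nonneg (g := fun s => g (1, s)) (h := fun s => γ 1 - δ s)
    (by fun_prop) (by fun_prop) (fun s => hgf _) Complex.I_ne_zero (fun s => by simpa using hδ s)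
  simp only [Path.source, Path.target, ← Complex.ofReal_sub] at e1 e2 e3 e4
  replace e1 := congrArg Complex.im e1
  replace e2 := congrArg Complex.im e2
  replace e3 := congrArg Complex.im e3
  replace e4 := congrArg Complex.im e4
  rw [Complex.sub_im, Complex.sub_im, log_neg_I_mul_ofReal_pos (by linarith),
    log_neg_I_mul_ofReal_neg (by linarith)] at e1
  rw [Complex.sub_im, Complex.sub_im, log_neg_I_mul_ofReal_neg (by linarith),
    log_neg_I_mul_ofReal_neg (by linarith)] at e2
  rw [Complex.sub_im, Complex.sub_im, log_I_mul_ofReal_neg (by linarith),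
    log_I_mul_ofReal_neg (by linarith)] at e3
  rw [Complex.sub_im, Complex.sub_im, log_I_mul_ofReal_neg (by linarith),
    log_I_mul_ofReal_pos (by linarith)] at e4
  -- From (0,0) to (1,1) the argument changes by -2π through (1,0), but by 0 through (0,1).
  linarith [Real.pi_pos]

/-- Sets in the closed upper half plane joining interleaved pairs of real points meet. -/
theorem JoinedIn.inter_nonempty_of_interleaved {F F' : Set ℂ} (hF : ∀ z ∈ F, 0 ≤ z.im)
    (hF' : ∀ z ∈ F', 0 ≤ z.im) {p q p' q' : ℂ} (hp : p.im = 0) (hq : q.im = 0) (hp' : p'.im = 0)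
    (hq' : q'.im = 0) (h : JoinedIn F p q) (h' : JoinedIn F' p' q') (h₁ : p.re < p'.re)
    (h₂ : p'.re < q.re) (h₃ : q.re < q'.re) : (F ∩ F').Nonempty := by
  obtain ⟨γ, hγ⟩ := h
  obtain ⟨δ, hδ⟩ := h'
  have real : ∀ z : ℂ, z.im = 0 → ((z.re : ℝ) : ℂ) = z := fun z hz => Complex.ext rfl hz.symm
  obtain ⟨s, t, hst⟩ := Path.exists_eq_of_interleaved h₁ h₂ h₃
    (γ.cast (real p hp) (real q hq)) (δ.cast (real p' hp') (real q' hq'))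
    (fun s => hF _ (hγ s)) (fun s => hF' _ (hδ s))
  exact ⟨γ s, hγ s, (show γ s = δ t from hst) ▸ hδ t⟩

/-! ### Leveled trees and the leaves of their subtrees -/

/-- A rooted tree on `V`, given by depths and parents, in which all leaves have depth `height`. -/
structure LeveledTree (V : Type*) where
  root : V
  height : ℕ
  depth : V → ℕ
  parent : V → V
  depth_le : ∀ v, depth v ≤ height
  eq_root : ∀ v, depth v = 0 → v = root
  depth_root : depth root = 0
  depth_parent : ∀ v, depth v ≠ 0 → depth (parent v) + 1 = depth v
  exists_child : ∀ v, depth v < height → ∃ c, depth c = depth v + 1 ∧ parent c = v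

namespace LeveledTree

variable {V : Type*} (R : LeveledTree V)

/-- The leaves that are descendants of `v`. -/
def leavesBelow (v : V) : Set V :=
  {q | R.depth q = R.height ∧ R.parent^[R.height - R.depth v] q = v}

theorem depth_iterate_parent (v : V) (i : ℕ) (hi : i ≤ R.depth v) :
    R.depth (R.parent^[i] v) + i = R.depth v := by
  induction i with
  | zero => rfl
  | succ i ih =>
    have := ih (by omega)
    rw [Function.iterate_succ_apply']
    have := R.depth_parent (R.parent^[i] v) (by omega)
    omega

theorem leavesBelow_of_depth_eq {v : V} (hv : R.depth v = R.height) : R.leavesBelow v = {v} := by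
  ext q
  simp only [leavesBelow, hv, Nat.sub_self, Function.iterate_zero, id, Set.mem_ofPred_eq,
    Set.mem_singleton_iff, and_iff_right_iff_imp]
  rintro rfl
  exact hv

theorem mem_leavesBelow_iff {v : V} (hv : R.depth v < R.height) {q : V} :
    q ∈ R.leavesBelow v ↔
      ∃ c, R.depth c = R.depth v + 1 ∧ R.parent c = v ∧ q ∈ R.leavesBelow c := by
  constructor
  · rintro ⟨hq, hqv⟩
    have hd := R.depth_iterate_parent q (R.height - (R.depth v + 1)) (by omega)
    refine ⟨R.parent^[R.height - (R.depth v + 1)] q, by omega, ?_, hq, ?_⟩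
    · rw [← Function.iterate_succ_apply' R.parent]
      rwa [show (R.height - (R.depth v + 1)).succ = R.height - R.depth v by omega]
    · congr 2; omega
  · rintro ⟨c, hc, rfl, hq, hqc⟩
    refine ⟨hq, ?_⟩
    rw [show R.height - R.depth (R.parent c) = (R.height - R.depth c) + 1 by omega,
      Function.iterate_succ_apply', hqc]

theorem leavesBelow_subset_of_mem {u v q : V} (hu : q ∈ R.leavesBelow u)
    (hv : q ∈ R.leavesBelow v) (huv : R.depth u ≤ R.depth v) :
    R.leavesBelow v ⊆ R.leavesBelow u := by
  have key : ∀ q ∈ R.leavesBelow v, R.parent^[R.height - R.depth u] q =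
      R.parent^[R.depth v - R.depth u] v := by
    intro q hq
    have := R.depth_le v
    rw [show R.height - R.depth u = (R.depth v - R.depth u) + (R.height - R.depth v) by omega,
      Function.iterate_add_apply, hq.2]
  exact fun q' hq' => ⟨hq'.1, by rw [key q' hq', ← key q hv, hu.2]⟩

theorem eq_of_mem_leavesBelow {u v q : V} (hu : q ∈ R.leavesBelow u)
    (hv : q ∈ R.leavesBelow v) (huv : R.depth u = R.depth v) : u = v := by
  rw [← hu.2, ← hv.2, huv]

theorem leavesBelow_nonempty (v : V) : (R.leavesBelow v).Nonempty := by
  obtain ⟨n, hn⟩ : ∃ n, R.height - R.depth v = n := ⟨_, rfl⟩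
  induction n generalizing v with
  | zero =>
    have := R.depth_le v
    exact ⟨v, by rw [R.leavesBelow_of_depth_eq (by omega)]; rfl⟩
  | succ n ih =>
    obtain ⟨c, hc, hcv⟩ := R.exists_child v (by omega)
    obtain ⟨q, hq⟩ := ih c (by omega)
    exact ⟨q, (R.mem_leavesBelow_iff (by omega)).2 ⟨c, hc, hcv, hq⟩⟩

variable [Finite V]

theorem ncard_leavesBelow_le {D : ℕ}
    (hD : ∀ v, {c | R.depth c = R.depth v + 1 ∧ R.parent c = v}.ncard ≤ D) (v : V) :
    (R.leavesBelow v).ncard ≤ D ^ (R.height - R.depth v) := by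
  obtain ⟨n, hn⟩ : ∃ n, R.height - R.depth v = n := ⟨_, rfl⟩
  induction n generalizing v with
  | zero =>
    have := R.depth_le v
    rw [R.leavesBelow_of_depth_eq (by omega), hn]
    simp
  | succ n ih =>
    set C : Set V := {c | R.depth c = R.depth v + 1 ∧ R.parent c = v} with hC
    have hfin : C.Finite := C.toFinite
    have heq : R.leavesBelow v = ⋃ c ∈ hfin.toFinset, R.leavesBelow c := by
      ext q
      rw [R.mem_leavesBelow_iff (by omega)]
      simp [hC, and_assoc]
    rw [heq, hn]
    calc _ ≤ ∑ c ∈ hfin.toFinset, (R.leavesBelow c).ncard := Finset.set_ncard_biUnion_le _ _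
      _ ≤ ∑ c ∈ hfin.toFinset, D ^ n := by
        refine Finset.sum_le_sum fun c hc => ?_
        have hc : R.depth c = R.depth v + 1 ∧ R.parent c = v := by simpa [hC] using hc
        have := ih c (by omega)
        rwa [show R.height - R.depth c = n by omega] at this
      _ = C.ncard * D ^ n := by
        rw [Finset.sum_const, smul_eq_mul, Set.ncard_eq_toFinset_card C hfin]
      _ ≤ D * D ^ n := Nat.mul_le_mul_right _ (hD v)
      _ = D ^ (n + 1) := by ring

end LeveledTree

/-! ### Cutting the cyclic order of the leaves -/

/-- The points `a`, `b`, `c`, `d` appear in this cyclic order with respect to `x`. -/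
def CyclicallyOrdered {V : Type*} (x : V → ℝ) (a b c d : V) : Prop :=
  (x a < x b ∧ x b < x c ∧ x c < x d) ∨ (x b < x c ∧ x c < x d ∧ x d < x a) ∨
    (x c < x d ∧ x d < x a ∧ x a < x b) ∨ (x d < x a ∧ x a < x b ∧ x b < x c)

/-- Cut just before `p`: everything left of `p` is shifted to the right by more than the spread of
`x`. -/
theorem exists_rotation {V : Type*} [Finite V] (x : V → ℝ) (p : V) :
    ∃ y : V → ℝ, (∀ a b, y a = y b → x a = x b) ∧
      (∀ a b, x p ≤ x a → x p ≤ x b → x a < x b → y a < y b) ∧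
      (∀ a b, x p ≤ x a → x b < x p → y a < y b) ∧
      ∀ a b c d, CyclicallyOrdered y a b c d → CyclicallyOrdered x a b c d := by
  obtain ⟨C, hC⟩ : ∃ C, ∀ a b, x a < x b + C := by
    obtain ⟨B, hB⟩ := (Set.finite_range x).bddAbove
    obtain ⟨B', hB'⟩ := (Set.finite_range x).bddBelow
    refine ⟨B - B' + 1, fun a b => ?_⟩
    have := hB ⟨a, rfl⟩
    have := hB' ⟨b, rfl⟩
    linarith
  have hlin : ∀ a b c d : V, ∀ y : V → ℝ, (∀ q, y q = if x q < x p then x q + C else x q) →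
      (y a < y b ∧ y b < y c ∧ y c < y d) → CyclicallyOrdered x a b c d := by
    intro a b c d y hy
    have := hC b a
    have := hC c b
    have := hC d c
    have := hC a d
    simp only [hy, CyclicallyOrdered]
    grind
  refine ⟨fun q => if x q < x p then x q + C else x q, fun a b => ?_, ?_, ?_, ?_⟩
  · have := hC a b
    have := hC b a
    grind
  · grind
  · intro a b
    have := hC a b
    grind
  · rintro a b c d (h | h | h | h)
    · exact hlin a b c d _ (fun _ => rfl) h
    · have := hlin b c d a _ (fun _ => rfl) h
      unfold CyclicallyOrdered at *; tauto
    · have := hlin c d a b _ (fun _ => rfl) h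
      unfold CyclicallyOrdered at *; tauto
    · have := hlin d a b c _ (fun _ => rfl) h
      unfold CyclicallyOrdered at *; tauto

namespace LeveledTree

variable {V : Type*} (R : LeveledTree V) [Finite V]

/-- If no subtree crosses its complement with respect to the cyclic order of the leaves, then this
cyclic order can be cut so that the leaves of every subtree are consecutive. -/
theorem exists_rotation_ordConnected (x : V → ℝ)
    (hx : Set.InjOn x {q | R.depth q = R.height})
    (hcross : ∀ v, ∀ a ∈ R.leavesBelow v, ∀ a' ∈ R.leavesBelow v, ∀ b b',
      R.depth b = R.height → R.depth b' = R.height → b ∉ R.leavesBelow v →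
      b' ∉ R.leavesBelow v → ¬ CyclicallyOrdered x a b a' b') :
    ∃ y : V → ℝ, Set.InjOn y {q | R.depth q = R.height} ∧
      (∀ v, ∀ a ∈ R.leavesBelow v, ∀ a' ∈ R.leavesBelow v, ∀ b,
        R.depth b = R.height → y a < y b → y b < y a' → b ∈ R.leavesBelow v) ∧
      ∀ a b c d, CyclicallyOrdered y a b c d → CyclicallyOrdered x a b c d := by
  classical
  by_cases htriv : ∀ v, R.leavesBelow v = {q | R.depth q = R.height}
  · exact ⟨x, hx, fun v a _ a' _ b hb _ _ => by rw [htriv v]; exact hb, fun _ _ _ _ h => h⟩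
  push Not at htriv
  -- A proper subtree of least depth: any other proper subtree is contained in it or disjoint from
  -- it.
  obtain ⟨c, hc, hmin⟩ := Set.exists_min_image {v | R.leavesBelow v ≠ {q | R.depth q = R.height}}
    R.depth (Set.toFinite _) htriv
  have hsub : ∀ v, R.leavesBelow v ⊆ {q | R.depth q = R.height} := fun v q hq => hq.1
  -- `A` is the leaf set of `c` or its complement, whichever misses the first leaf `f`. A cyclic
  -- interval that misses `f` is an interval of the linear order, so cutting before its first leaf
  -- `p` moves all of `A` to the front.
  obtain ⟨A, hAsub, hAne, hAne', hAlam, hAcross, f, hf, hfA, hfmin⟩ :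
      ∃ A : Set V, A ⊆ {q | R.depth q = R.height} ∧ A.Nonempty ∧
      (∃ b, R.depth b = R.height ∧ b ∉ A) ∧
      (∀ v, R.leavesBelow v = {q | R.depth q = R.height} ∨ R.leavesBelow v ⊆ A ∨
        Disjoint (R.leavesBelow v) A) ∧
      (∀ a ∈ A, ∀ a' ∈ A, ∀ b b', R.depth b = R.height → R.depth b' = R.height → b ∉ A →
        b' ∉ A → ¬ CyclicallyOrdered x a b a' b') ∧
      ∃ f, R.depth f = R.height ∧ f ∉ A ∧ ∀ q, R.depth q = R.height → x f ≤ x q := by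
    obtain ⟨f, hf, hfmin⟩ := Set.exists_min_image {q | R.depth q = R.height} x (Set.toFinite _)
      ((R.leavesBelow_nonempty c).mono (hsub c))
    have hlam : ∀ v, R.leavesBelow v = {q | R.depth q = R.height} ∨
        R.leavesBelow v ⊆ R.leavesBelow c ∨ Disjoint (R.leavesBelow v) (R.leavesBelow c) := by
      intro v
      by_cases hv : R.leavesBelow v = {q | R.depth q = R.height}
      · exact Or.inl hv
      · by_cases hd : Disjoint (R.leavesBelow v) (R.leavesBelow c)
        · exact Or.inr (Or.inr hd)
        · obtain ⟨q, hqv, hqc⟩ := Set.not_disjoint_iff.1 hd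
          exact Or.inr (Or.inl (R.leavesBelow_subset_of_mem hqc hqv (hmin v hv)))
    have hex : ∃ b, R.depth b = R.height ∧ b ∉ R.leavesBelow c := by
      by_contra! hcon
      exact hc (Set.Subset.antisymm (hsub c) hcon)
    by_cases hfc : f ∈ R.leavesBelow c
    · refine ⟨{q | R.depth q = R.height} \ R.leavesBelow c, Set.sdiff_subset, ?_,
        ⟨f, hf, fun h => h.2 hfc⟩, ?_, ?_, f, hf, fun h => h.2 hfc, hfmin⟩
      · obtain ⟨b, hb⟩ := hex
        exact ⟨b, hb⟩
      · intro v
        rcases hlam v with h | h | h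
        · exact Or.inl h
        · exact Or.inr (Or.inr (Set.disjoint_left.2 fun q hq hq' => hq'.2 (h hq)))
        · exact Or.inr (Or.inl fun q hq => ⟨hq.1, Set.disjoint_left.1 h hq⟩)
      · intro a ha a' ha' b b' hb hb' hbA hbA' hcyc
        have hbc : b ∈ R.leavesBelow c := by by_contra h; exact hbA ⟨hb, h⟩
        have hbc' : b' ∈ R.leavesBelow c := by by_contra h; exact hbA' ⟨hb', h⟩
        refine hcross c b hbc b' hbc' a' a ha'.1 ha.1 ha'.2 ha.2 ?_
        unfold CyclicallyOrdered at *
        tauto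
    · exact ⟨R.leavesBelow c, hsub c, R.leavesBelow_nonempty c, hex, hlam, hcross c, f, hf, hfc,
        hfmin⟩
  obtain ⟨p, hpA, hpmin⟩ := Set.exists_min_image A x (Set.toFinite _) hAne
  obtain ⟨y, hyx, hyge, hylt, hycyc⟩ := exists_rotation x p
  have hlt : ∀ a ∈ A, ∀ b, R.depth b = R.height → b ∉ A → y a < y b := by
    intro a ha b hb hbA
    rcases lt_or_ge (x b) (x p) with hbp | hbp
    · exact hylt a b (hpmin a ha) hbp
    · refine hyge a b (hpmin a ha) hbp ?_
      by_contra! hba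
      have h1 : x b < x a := lt_of_le_of_ne hba fun h => hbA (hx hb (hAsub ha) h ▸ ha)
      have h2 : x p < x b := lt_of_le_of_ne hbp fun h => hbA (hx (hAsub hpA) hb h ▸ hpA)
      have h3 : x f < x p := lt_of_le_of_ne (hfmin p (hAsub hpA))
        fun h => hfA (hx hf (hAsub hpA) h ▸ hpA)
      exact hAcross p hpA a ha b f hb hf hbA hfA (Or.inr (Or.inr (Or.inr ⟨h3, h2, h1⟩)))
  refine ⟨y, fun a ha b hb hab => hx ha hb (hyx a b hab), ?_, hycyc⟩
  intro v a ha a' ha' b hb hab hba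
  by_contra hbv
  -- A violation at `v` becomes a crossing with a fourth leaf outside `v`: one after `A` if `v` lies
  -- inside `A`, and `p` if `v` is disjoint from `A`.
  rcases hAlam v with h | h | h
  · exact hbv (h ▸ hb)
  · obtain ⟨b', hb', hbA'⟩ := hAne'
    exact hcross v a ha a' ha' b b' hb hb' hbv (fun hv => hbA' (h hv))
      (hycyc _ _ _ _ (Or.inl ⟨hab, hba, hlt a' (h ha') b' hb' hbA'⟩))
  · exact hcross v a ha a' ha' b p hb (hAsub hpA) hbv (Set.disjoint_right.1 h hpA)
      (hycyc _ _ _ _ (Or.inr (Or.inr (Or.inr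
        ⟨hlt p hpA a ha.1 (Set.disjoint_left.1 h ha), hab, hba⟩))))

end LeveledTree

/-! ### Nesting of leaves under a noncrossing matching -/

namespace LeveledTree

variable {V : Type*} (R : LeveledTree V)

/-- `y` lists the leaves such that those below any vertex are consecutive, and `m` is a perfect
matching of the leaves without crossings. -/
structure NoncrossingMatching (y : V → ℝ) (m : V → V) : Prop where
  injOn : Set.InjOn y {q | R.depth q = R.height}
  ordConnected : ∀ v, ∀ a ∈ R.leavesBelow v, ∀ a' ∈ R.leavesBelow v, ∀ b,
    R.depth b = R.height → y a < y b → y b < y a' → b ∈ R.leavesBelow v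
  depth_partner : ∀ q, R.depth q = R.height → R.depth (m q) = R.height
  partner_partner : ∀ q, R.depth q = R.height → m (m q) = q
  noncrossing : ∀ a b, R.depth a = R.height → R.depth b = R.height →
    ¬ (y a < y b ∧ y b < y (m a) ∧ y (m a) < y (m b))

/-- The left ends of the matching edges that enclose `q`. -/
def enclosing (y : V → ℝ) (m : V → V) (q : V) : Set V :=
  {a | R.depth a = R.height ∧ y a < y q ∧ y q < y (m a)}

/-- The number of matching edges that enclose `q`. -/
noncomputable def nesting (y : V → ℝ) (m : V → V) (q : V) : ℕ :=
  (R.enclosing y m q).ncard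

/-- The least nesting of the leaves below `v`. -/
noncomputable def minNesting (y : V → ℝ) (m : V → V) (v : V) : ℕ :=
  sInf (R.nesting y m '' R.leavesBelow v)

/-- The position of the leftmost leaf below `v`. -/
noncomputable def leftmost (y : V → ℝ) (v : V) : ℝ :=
  sInf (y '' R.leavesBelow v)

/-- The minimal nesting, scaled by the maximal possible number of leaves below `v`. -/
noncomputable def scaledNesting (D : ℕ) (y : V → ℝ) (m : V → V) (v : V) : ℕ :=
  R.minNesting y m v / D ^ (R.height - R.depth v)

theorem exists_nesting_eq_minNesting (y : V → ℝ) (m : V → V) (v : V) :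
    ∃ q ∈ R.leavesBelow v, R.nesting y m q = R.minNesting y m v :=
  Nat.sInf_mem ((R.leavesBelow_nonempty v).image _)

theorem minNesting_le (y : V → ℝ) (m : V → V) {v q : V} (hq : q ∈ R.leavesBelow v) :
    R.minNesting y m v ≤ R.nesting y m q :=
  Nat.sInf_le ⟨q, hq, rfl⟩

theorem leavesBelow_parent {c u : V} (hc : R.depth c = R.depth u + 1) (hcu : R.parent c = u) :
    R.leavesBelow c ⊆ R.leavesBelow u := by
  have := R.depth_le c
  exact fun q hq => (R.mem_leavesBelow_iff (by omega)).2 ⟨c, hc, hcu, hq⟩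

theorem minNesting_parent_le (y : V → ℝ) (m : V → V) {c u : V}
    (hc : R.depth c = R.depth u + 1) (hcu : R.parent c = u) :
    R.minNesting y m u ≤ R.minNesting y m c := by
  obtain ⟨q, hq, hqe⟩ := R.exists_nesting_eq_minNesting y m c
  exact hqe ▸ R.minNesting_le y m (R.leavesBelow_parent hc hcu hq)

variable [Finite V]

theorem exists_eq_leftmost (y : V → ℝ) (v : V) :
    ∃ q ∈ R.leavesBelow v, y q = R.leftmost y v :=
  ((R.leavesBelow_nonempty v).image y).csInf_mem (Set.toFinite _)

theorem leftmost_le (y : V → ℝ) {v q : V} (hq : q ∈ R.leavesBelow v) :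
    R.leftmost y v ≤ y q :=
  csInf_le (Set.toFinite _).bddBelow ⟨q, hq, rfl⟩

/-- The leaves counted lie below the at most `D - 1` siblings of `c`. -/
theorem ncard_leavesBelow_diff_le {D : ℕ}
    (hD : ∀ v, {c | R.depth c = R.depth v + 1 ∧ R.parent c = v}.ncard ≤ D) {c u : V}
    (hc : R.depth c = R.depth u + 1) (hcu : R.parent c = u) :
    (R.leavesBelow u \ R.leavesBelow c).ncard ≤ (D - 1) * D ^ (R.height - R.depth c) := by
  set C : Set V := {c | R.depth c = R.depth u + 1 ∧ R.parent c = u} with hC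
  have hfin : (C \ {c}).Finite := Set.toFinite _
  have hcC : c ∈ C := ⟨hc, hcu⟩
  have hcle := R.depth_le c
  have hsub : R.leavesBelow u \ R.leavesBelow c ⊆ ⋃ c' ∈ hfin.toFinset, R.leavesBelow c' := by
    rintro q ⟨hq, hqc⟩
    obtain ⟨c', hc', hcu', hqc'⟩ := (R.mem_leavesBelow_iff (by omega)).1 hq
    simp only [Set.Finite.mem_toFinset, Set.mem_iUnion, exists_prop]
    exact ⟨c', ⟨⟨hc', hcu'⟩, fun h => hqc (h ▸ hqc')⟩, hqc'⟩
  calc _ ≤ (⋃ c' ∈ hfin.toFinset, R.leavesBelow c').ncard := Set.ncard_le_ncard hsub (Set.toFinite _)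
    _ ≤ ∑ c' ∈ hfin.toFinset, (R.leavesBelow c').ncard := Finset.set_ncard_biUnion_le _ _
    _ ≤ ∑ c' ∈ hfin.toFinset, D ^ (R.height - R.depth c) := by
      refine Finset.sum_le_sum fun c' hc' => ?_
      have hc' : c' ∈ C \ {c} := by simpa only [Set.Finite.mem_toFinset] using hc'
      have := R.ncard_leavesBelow_le hD c'
      rwa [show R.depth c' = R.depth c by rw [hc, hc'.1.1]] at this
    _ = (C \ {c}).ncard * D ^ (R.height - R.depth c) := by
      rw [Finset.sum_const, smul_eq_mul, Set.ncard_eq_toFinset_card _ hfin]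
    _ ≤ (D - 1) * D ^ (R.height - R.depth c) := by
      refine Nat.mul_le_mul_right _ ?_
      rw [Set.ncard_sdiff_singleton_of_mem hcC]
      exact Nat.sub_le_sub_right (hD u) 1

/-- An edge over `q` but not over `p` has its left end between them, possibly at `p`. -/
theorem nesting_le_add_left (y : V → ℝ) (m : V → V) {p q : V} (hpq : y p < y q) :
    R.nesting y m q ≤
      R.nesting y m p + {b | R.depth b = R.height ∧ y p ≤ y b ∧ y b < y q}.ncard := by
  refine le_trans (Set.ncard_le_ncard ?_ (Set.toFinite _)) (Set.ncard_union_le _ _)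
  rintro a ⟨ha, h1, h2⟩
  by_cases h : y a < y p
  · exact Or.inl ⟨ha, h, hpq.trans h2⟩
  · exact Or.inr ⟨ha, not_lt.1 h, h1⟩

namespace NoncrossingMatching

variable {R} {y : V → ℝ} {m : V → V} (hm : R.NoncrossingMatching y m)
include hm

-- An edge over just one of `q` and `m q` would cross the edge joining them or share an end with it,
-- hence coincide with it.
omit [Finite V] in
theorem enclosing_partner {q : V} (hq : R.depth q = R.height) :
    R.enclosing y m (m q) = R.enclosing y m q := by
  have key : ∀ q, R.depth q = R.height → R.enclosing y m q ⊆ R.enclosing y m (m q) := by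
    rintro q hq a ⟨ha, h1, h2⟩
    have hmq := hm.depth_partner q hq
    have hma := hm.depth_partner a ha
    refine ⟨ha, ?_, ?_⟩
    · by_contra! h
      rcases h.lt_or_eq with h | h
      · exact hm.noncrossing (m q) a hmq ha (by rw [hm.partner_partner q hq]; exact ⟨h, h1, h2⟩)
      · have : m q = a := hm.injOn hmq ha h
        rw [← this, hm.partner_partner q hq] at h2
        exact lt_irrefl _ h2
    · by_contra! h
      rcases h.lt_or_eq with h | h
      · exact hm.noncrossing a q ha hq ⟨h1, h2, h⟩
      · have h : m a = m q := hm.injOn hma hmq h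
        have : a = q := by rw [← hm.partner_partner a ha, h, hm.partner_partner q hq]
        rw [this] at h1
        exact lt_irrefl _ h1
  refine Set.Subset.antisymm ?_ (key q hq)
  have := key (m q) (hm.depth_partner q hq)
  rwa [hm.partner_partner q hq] at this

omit [Finite V] in
theorem nesting_partner {q : V} (hq : R.depth q = R.height) :
    R.nesting y m (m q) = R.nesting y m q := by
  unfold nesting
  rw [hm.enclosing_partner hq]

/-- Edges over `a` are also over its partner, hence over `b`; the edge at `a` is an additional one
over `b`. -/
theorem nesting_lt {a b : V} (ha : R.depth a = R.height) (hab : y a < y b)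
    (hb : y b < y (m a)) : R.nesting y m a < R.nesting y m b := by
  refine Set.ncard_lt_ncard ⟨?_, fun h => ?_⟩ (Set.toFinite _)
  · intro c hc
    have hc' : c ∈ R.enclosing y m (m a) := by rwa [hm.enclosing_partner ha]
    exact ⟨hc.1, hc.2.1.trans hab, hb.trans hc'.2.2⟩
  · exact lt_irrefl _ (h (show a ∈ R.enclosing y m b from ⟨ha, hab, hb⟩)).2.1

/-- An edge over `q` but not over `p` has its right end between them; counting by right ends uses
that `m` is injective on leaves. -/
theorem nesting_le_add_right {p q : V} (hqp : y q < y p) :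
    R.nesting y m q ≤
      R.nesting y m p + {b | R.depth b = R.height ∧ y q < y b ∧ y b ≤ y p}.ncard := by
  have h1 : R.enclosing y m q ⊆ R.enclosing y m p ∪
      {a | R.depth a = R.height ∧ y q < y (m a) ∧ y (m a) ≤ y p} := by
    rintro a ⟨ha, h1, h2⟩
    by_cases h : y p < y (m a)
    · exact Or.inl ⟨ha, h1.trans hqp, h⟩
    · exact Or.inr ⟨ha, h2, not_lt.1 h⟩
  refine (Set.ncard_le_ncard h1 (Set.toFinite _)).trans
    ((Set.ncard_union_le _ _).trans (Nat.add_le_add_left ?_ _))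
  refine Set.ncard_le_ncard_of_injOn m ?_ ?_ (Set.toFinite _)
  · rintro a ⟨ha, h⟩
    exact ⟨hm.depth_partner a ha, h⟩
  · rintro a ⟨ha, -⟩ b ⟨hb, -⟩ hab
    rw [← hm.partner_partner a ha, hab, hm.partner_partner b hb]

/-- Go from a leaf `p` below `u` of minimal nesting to the nearest leaf `q` below `c`. The leaves
passed are below `u`, since its leaves are consecutive, but not below `c`, by the choice of `q`. -/
theorem minNesting_child_le {D : ℕ}
    (hD : ∀ v, {c | R.depth c = R.depth v + 1 ∧ R.parent c = v}.ncard ≤ D) {c u : V}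
    (hc : R.depth c = R.depth u + 1) (hcu : R.parent c = u) :
    R.minNesting y m c ≤ R.minNesting y m u + (D - 1) * D ^ (R.height - R.depth c) := by
  obtain ⟨p, hp, hpe⟩ := R.exists_nesting_eq_minNesting y m u
  rw [← hpe]
  by_cases hpc : p ∈ R.leavesBelow c
  · exact (R.minNesting_le y m hpc).trans (Nat.le_add_right _ _)
  obtain ⟨q, hq, hqmin⟩ := Set.exists_min_image (R.leavesBelow c) (fun q => |y q - y p|)
    (Set.toFinite _) (R.leavesBelow_nonempty c)
  have hqu := R.leavesBelow_parent hc hcu hq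
  have hne : y p ≠ y q := fun h => hpc (hm.injOn hp.1 hq.1 h ▸ hq)
  refine (R.minNesting_le y m hq).trans ?_
  have hcard := R.ncard_leavesBelow_diff_le hD hc hcu
  rcases lt_or_gt_of_ne hne with h | h
  · refine (R.nesting_le_add_left y m h).trans (Nat.add_le_add_left (le_trans
      (Set.ncard_le_ncard ?_ (Set.toFinite _)) hcard) _)
    rintro b ⟨hb, h1, h2⟩
    constructor
    · rcases h1.lt_or_eq with h1 | h1
      · exact hm.ordConnected u p hp q hqu b hb h1 h2
      · exact hm.injOn hp.1 hb h1 ▸ hp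
    · intro hbc
      have := hqmin b hbc
      rw [abs_of_nonneg (by linarith), abs_of_nonneg (by linarith)] at this
      linarith
  · refine (hm.nesting_le_add_right h).trans (Nat.add_le_add_left (le_trans
      (Set.ncard_le_ncard ?_ (Set.toFinite _)) hcard) _)
    rintro b ⟨hb, h1, h2⟩
    constructor
    · rcases h2.lt_or_eq with h2 | h2
      · exact hm.ordConnected u q hqu p hp b hb h1 h2
      · exact hm.injOn hb hp.1 h2 ▸ hp
    · intro hbc
      have := hqmin b hbc
      rw [abs_of_nonpos (by linarith), abs_of_nonpos (by linarith)] at this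
      linarith

/-- With N = D^(height - depth c), the quotient of the minimal nesting by N grows by at most D - 1
from `u` to `c`. Rounding the quotient at `u` down to a multiple of D loses at most another D - 1.
-/
theorem scaledNesting_child {D : ℕ} (hD0 : 0 < D)
    (hD : ∀ v, {c | R.depth c = R.depth v + 1 ∧ R.parent c = v}.ncard ≤ D) {c u : V}
    (hc : R.depth c = R.depth u + 1) (hcu : R.parent c = u) :
    D * R.scaledNesting D y m u ≤ R.scaledNesting D y m c ∧
      R.scaledNesting D y m c + 2 ≤ D * R.scaledNesting D y m u + 2 * D := by
  have hle := R.depth_le c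
  have h1 := R.minNesting_parent_le y m hc hcu
  have h2 := hm.minNesting_child_le hD hc hcu
  unfold scaledNesting
  rw [show R.height - R.depth u = (R.height - R.depth c) + 1 by omega, pow_succ,
    ← Nat.div_div_eq_div_mul]
  set N := D ^ (R.height - R.depth c)
  have hN : 0 < N := by positivity
  have h3 := Nat.div_le_div_right (c := N) h1
  have h4 := Nat.div_le_div_right (c := N) h2
  rw [Nat.add_mul_div_right _ _ hN] at h4
  have h5 := Nat.div_add_mod (R.minNesting y m u / N) D
  have h6 := Nat.mod_lt (R.minNesting y m u / N) hD0
  omega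

/-- Subtrees rooted at equal depth have disjoint leaf intervals, so their first leaves decide the
order. -/
theorem lt_of_leftmost_lt {u w : V} (huw : R.depth u = R.depth w)
    (h : R.leftmost y u < R.leftmost y w) {a b : V} (ha : a ∈ R.leavesBelow u)
    (hb : b ∈ R.leavesBelow w) : y a < y b := by
  obtain ⟨p, hp, hpe⟩ := R.exists_eq_leftmost y u
  have hpb : y p < y b := hpe ▸ h.trans_le (R.leftmost_le y hb)
  have hbu : b ∉ R.leavesBelow u := fun hbu => by
    rw [R.eq_of_mem_leavesBelow hbu hb huw] at h
    exact lt_irrefl _ h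
  by_contra! hba
  rcases hba.lt_or_eq with hba | hba
  · exact hbu (hm.ordConnected u p hp a ha b hb.1 hpb hba)
  · exact hbu (hm.injOn hb.1 ha.1 hba ▸ ha)

theorem eq_of_leftmost_eq {u w : V} (huw : R.depth u = R.depth w)
    (h : R.leftmost y u = R.leftmost y w) : u = w := by
  obtain ⟨p, hp, hpe⟩ := R.exists_eq_leftmost y u
  obtain ⟨q, hq, hqe⟩ := R.exists_eq_leftmost y w
  have : p = q := hm.injOn hp.1 hq.1 (by rw [hpe, hqe, h])
  exact R.eq_of_mem_leavesBelow hp (this ▸ hq) huw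

theorem leftmost_child_lt {u w c d : V} (huw : R.depth u = R.depth w)
    (h : R.leftmost y u < R.leftmost y w) (hc : R.depth c = R.depth u + 1)
    (hcu : R.parent c = u) (hd : R.depth d = R.depth w + 1) (hdw : R.parent d = w) :
    R.leftmost y c < R.leftmost y d := by
  obtain ⟨p, hp, hpe⟩ := R.exists_eq_leftmost y c
  obtain ⟨q, hq, hqe⟩ := R.exists_eq_leftmost y d
  rw [← hpe, ← hqe]
  exact hm.lt_of_leftmost_lt huw h (R.leavesBelow_parent hc hcu hp)
    (R.leavesBelow_parent hd hdw hq)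

end NoncrossingMatching

omit [Finite V] in
theorem leftmost_of_depth_eq (y : V → ℝ) {q : V} (hq : R.depth q = R.height) :
    R.leftmost y q = y q := by
  simp [leftmost, R.leavesBelow_of_depth_eq hq]

omit [Finite V] in
theorem scaledNesting_of_depth_eq (D : ℕ) (y : V → ℝ) (m : V → V) {q : V}
    (hq : R.depth q = R.height) : R.scaledNesting D y m q = R.nesting y m q := by
  simp [scaledNesting, minNesting, R.leavesBelow_of_depth_eq hq, hq]

/-! ### The queue layout -/

/-- The lexicographic key of a vertex: depth, scaled nesting, and position from left to right. -/
noncomputable def layoutKey (D : ℕ) (y : V → ℝ) (m : V → V) (v : V) : ℕ ×ₗ ℕ ×ₗ ℝ :=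
  toLex (R.depth v, toLex (R.scaledNesting D y m v, R.leftmost y v))

omit [Finite V] in
theorem layoutKey_lt_iff {D : ℕ} {y : V → ℝ} {m : V → V} {u v : V} :
    R.layoutKey D y m u < R.layoutKey D y m v ↔
      R.depth u < R.depth v ∨ R.depth u = R.depth v ∧
        (R.scaledNesting D y m u < R.scaledNesting D y m v ∨
          R.scaledNesting D y m u = R.scaledNesting D y m v ∧
            R.leftmost y u < R.leftmost y v) := by
  simp [layoutKey, Prod.Lex.toLex_lt_toLex]

/-- The queue of an edge: edges between leaves share the last queue, the queue of a tree edge is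
determined by the change of the scaled nesting. -/
noncomputable def queueIndex (D : ℕ) (y : V → ℝ) (m : V → V) : Sym2 V → ℕ :=
  Sym2.lift ⟨fun u v =>
    if R.depth u = R.depth v then 2 * D - 1
    else if R.depth u < R.depth v then R.scaledNesting D y m v - D * R.scaledNesting D y m u
    else R.scaledNesting D y m u - D * R.scaledNesting D y m v, fun u v => by grind⟩

theorem nonempty_queueLayout {G : SimpleGraph V} {D : ℕ} (hD0 : 0 < D)
    (hD : ∀ v, {c | R.depth c = R.depth v + 1 ∧ R.parent c = v}.ncard ≤ D)
    {y : V → ℝ} {m : V → V} (hm : R.NoncrossingMatching y m)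
    (hG : ∀ u v, G.Adj u v → (R.depth v = R.depth u + 1 ∧ R.parent v = u) ∨
      (R.depth u = R.depth v + 1 ∧ R.parent u = v) ∨
      (R.depth u = R.height ∧ R.depth v = R.height ∧ v = m u)) :
    Nonempty (QueueLayout G (2 * D)) := by
  have hinj : Function.Injective (R.layoutKey D y m) := by
    intro u v huv
    have h1 : R.depth u = R.depth v := congrArg (fun k => (ofLex k).1) huv
    have h2 : R.leftmost y u = R.leftmost y v :=
      congrArg (fun k => (ofLex (ofLex k).2).2) huv
    exact hm.eq_of_leftmost_eq h1 h2
  have hidx : ∀ e ∈ G.edgeSet, R.queueIndex D y m e < 2 * D := by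
    intro e
    induction e with
    | _ u v =>
      intro huv
      simp only [queueIndex, Sym2.lift_mk]
      rcases hG u v huv with ⟨h, hp⟩ | ⟨h, hp⟩ | ⟨h, h', -⟩
      · have := hm.scaledNesting_child hD0 hD h hp
        rw [if_neg (by omega), if_pos (by omega)]
        omega
      · have := hm.scaledNesting_child hD0 hD h hp
        rw [if_neg (by omega), if_neg (by omega)]
        omega
      · rw [if_pos (by omega)]
        omega
  refine ⟨⟨LinearOrder.lift' _ hinj, fun e => ⟨R.queueIndex D y m e, hidx e e.2⟩, ?_⟩⟩
  intro u₁ v₁ u₂ v₂ h₁ h₂ hu huv hv hq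
  replace hu : R.layoutKey D y m u₁ < R.layoutKey D y m u₂ := hu
  replace huv : R.layoutKey D y m u₂ < R.layoutKey D y m v₂ := huv
  replace hv : R.layoutKey D y m v₂ < R.layoutKey D y m v₁ := hv
  rw [layoutKey_lt_iff] at hu huv hv
  replace hq : R.queueIndex D y m s(u₁, v₁) = R.queueIndex D y m s(u₂, v₂) := congrArg Fin.val hq
  simp only [queueIndex, Sym2.lift_mk] at hq
  rcases hG u₁ v₁ h₁ with ⟨h, hp⟩ | ⟨h, hp⟩ | ⟨h, h', hp⟩
  · have hb := hm.scaledNesting_child hD0 hD h hp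
    rcases hG u₂ v₂ h₂ with ⟨k, kp⟩ | ⟨k, kp⟩ | ⟨k, k', kp⟩
    · have kb := hm.scaledNesting_child hD0 hD k kp
      have hd : R.depth u₁ = R.depth u₂ := by omega
      rw [if_neg (by omega), if_pos (by omega), if_neg (by omega), if_pos (by omega)] at hq
      replace hu := (hu.resolve_left (by omega)).2
      replace hv := (hv.resolve_left (by omega)).2
      -- Equal queues mean equal offsets s(v) - D s(u), so s(v₂) ≤ s(v₁) gives s(u₂) ≤ s(u₁). The
      -- parents then tie in s and differ by position, which their children inherit.
      have hs : R.scaledNesting D y m u₁ = R.scaledNesting D y m u₂ := by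
        refine le_antisymm (by omega) ?_
        refine le_of_mul_le_mul_left ?_ hD0
        omega
      rw [hs] at hq hb hu
      have := hm.leftmost_child_lt hd (by simpa using hu) h hp k kp
      rcases hv with hv | hv
      · omega
      · exact lt_asymm this hv.2
    · omega
    · rw [if_neg (by omega), if_pos (by omega), if_pos (by omega)] at hq
      omega
  · omega
  -- Both ends of the outer edge are leaves of equal nesting, so the inner ends are leaves with that
  -- nesting too. Hence they lie under the outer edge, which would make their nesting larger.
  · have hu₂ : R.depth u₂ = R.height := by omega
    have hv₂ : R.depth v₂ = R.height := by omega
    rw [R.scaledNesting_of_depth_eq D y m h, R.scaledNesting_of_depth_eq D y m hu₂,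
      R.leftmost_of_depth_eq y h, R.leftmost_of_depth_eq y hu₂] at hu
    rw [R.scaledNesting_of_depth_eq D y m hv₂, R.scaledNesting_of_depth_eq D y m hu₂,
      R.leftmost_of_depth_eq y hv₂, R.leftmost_of_depth_eq y hu₂] at huv
    rw [R.scaledNesting_of_depth_eq D y m hv₂, R.scaledNesting_of_depth_eq D y m h',
      R.leftmost_of_depth_eq y hv₂, R.leftmost_of_depth_eq y h'] at hv
    have heq : R.nesting y m v₁ = R.nesting y m u₁ := hp ▸ hm.nesting_partner h
    have h1 : y u₁ < y u₂ := by
      rcases hu with hu | ⟨-, hu | hu⟩ <;> [omega; omega; exact hu.2]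
    have h2 : y u₂ < y v₂ := by
      rcases huv with hu | ⟨-, hu | hu⟩ <;> [omega; omega; exact hu.2]
    have h3 : y v₂ < y v₁ := by
      rcases hv with hu | ⟨-, hu | hu⟩ <;> [omega; omega; exact hu.2]
    have := hm.nesting_lt h h1 (hp ▸ h2.trans h3)
    omega

end LeveledTree

/-! ### Leveled trees from rooted trees -/

section TreeParent

variable {V : Type*} {T : SimpleGraph V} {r : V}

/-- Two parents would give two paths from the root to `v`. -/
theorem eq_of_mem_treeChildren (hT : T.IsTree) {u w v : V} (hu : v ∈ treeChildren T r u)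
    (hw : v ∈ treeChildren T r w) : u = w := by
  obtain ⟨p, hp⟩ := hT.connected.exists_walk_length_eq_dist r u
  obtain ⟨q, hq⟩ := hT.connected.exists_walk_length_eq_dist r w
  have hp' : (p.concat hu.1).IsPath := SimpleGraph.Walk.isPath_of_length_eq_dist _ (by
    rw [SimpleGraph.Walk.length_concat, hp, hu.2])
  have hq' : (q.concat hw.1).IsPath := SimpleGraph.Walk.isPath_of_length_eq_dist _ (by
    rw [SimpleGraph.Walk.length_concat, hq, hw.2])
  exact (SimpleGraph.Walk.concat_inj ((hT.existsUnique_path r v).unique hp' hq')).1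

theorem exists_mem_treeChildren (hT : T.IsTree) {v : V} (hv : T.dist r v ≠ 0) :
    ∃ u, v ∈ treeChildren T r u := by
  obtain ⟨p, hp⟩ := hT.connected.exists_walk_length_eq_dist v r
  rw [SimpleGraph.dist_comm] at hp
  cases p with
  | nil => exact absurd hp.symm hv
  | cons h p =>
    rename_i w
    have hw := SimpleGraph.dist_le p
    rw [SimpleGraph.dist_comm] at hw
    rw [SimpleGraph.Walk.length_cons] at hp
    refine ⟨w, h.symm, ?_⟩
    rcases hT.dist_eq_dist_add_one_of_adj r h with h' | h' <;> omega

open Classical in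
/-- The parent of `v` in the tree `T` rooted at `r`; the root is its own parent. -/
noncomputable def treeParent (T : SimpleGraph V) (r v : V) : V :=
  if h : ∃ u, v ∈ treeChildren T r u then h.choose else v

theorem mem_treeChildren_treeParent (hT : T.IsTree) {v : V} (hv : T.dist r v ≠ 0) :
    v ∈ treeChildren T r (treeParent T r v) := by
  have h := exists_mem_treeChildren hT hv
  rw [treeParent, dif_pos h]
  exact h.choose_spec

theorem treeParent_eq (hT : T.IsTree) {u v : V} (h : v ∈ treeChildren T r u) :
    treeParent T r v = u :=
  eq_of_mem_treeChildren hT (mem_treeChildren_treeParent hT (by rw [h.2]; omega)) h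

theorem dist_le_treeHeight [Fintype V] (v : V) : T.dist r v ≤ treeHeight T r :=
  Finset.le_sup (f := fun v => T.dist r v) (Finset.mem_univ v)

theorem mem_treeLeaves_of_dist_eq [Fintype V] {v : V} (hv : T.dist r v = treeHeight T r) :
    v ∈ treeLeaves T r := by
  refine Set.eq_empty_of_forall_notMem fun c hc => ?_
  have := hc.2
  have := dist_le_treeHeight (T := T) (r := r) c
  omega

/-- The leveled tree of a rooted tree whose leaves all have the same depth. -/
noncomputable def leveledTree [Fintype V] (hT : T.IsTree)
    (hleaf : ∀ v ∈ treeLeaves T r, T.dist r v = treeHeight T r) : LeveledTree V where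
  root := r
  height := treeHeight T r
  depth := T.dist r
  parent := treeParent T r
  depth_le := dist_le_treeHeight
  eq_root v hv := (hT.connected.dist_eq_zero_iff.1 hv).symm
  depth_root := T.dist_self
  depth_parent v hv := (mem_treeChildren_treeParent hT hv).2.symm
  exists_child v hv := by
    by_contra! hcon
    refine hv.ne (hleaf v (Set.eq_empty_of_forall_notMem fun c hc => ?_))
    exact hcon c hc.2 (treeParent_eq hT hc)

end TreeParent

/-! ### Noncrossing from planarity -/

namespace GraphDrawing

variable {V : Type*} {G : SimpleGraph V} (D : GraphDrawing G)

/-- The part of the drawing that consists of the vertices in `X` and of the edges of `T` between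
them. -/
def inducedSupport (T : SimpleGraph V) (X : Set V) : Set ℂ :=
  D.pos '' X ∪ {z | ∃ u ∈ X, ∃ v ∈ X, ∃ h : G.Adj u v, T.Adj u v ∧ z ∈ Set.range (D.arc u v h)}

variable {D} {T : SimpleGraph V}

/-- By planarity a common point would force a common vertex of `X` and `Y`. -/
theorem disjoint_inducedSupport (hD : D.IsPlanar) {X Y : Set V} (hXY : Disjoint X Y) :
    Disjoint (D.inducedSupport T X) (D.inducedSupport T Y) := by
  have hne : ∀ x ∈ X, ∀ y ∈ Y, x ≠ y := fun x hx y hy h => Set.disjoint_left.1 hXY hx (h ▸ hy)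
  rw [Set.disjoint_left]
  rintro z (⟨x, hx, rfl⟩ | ⟨u, hu, v, hv, h, -, hz⟩) (⟨y, hy, hxy⟩ | ⟨u', hu', v', hv', h', -, hz'⟩)
  · exact hne x hx y hy (D.pos_injective hxy).symm
  · rcases D.arc_avoids u' v' h' x hz' with rfl | rfl
    · exact hne _ hx _ hu' rfl
    · exact hne _ hx _ hv' rfl
  · rw [← hxy] at hz
    rcases D.arc_avoids u v h y hz with rfl | rfl
    · exact hne _ hu _ hy rfl
    · exact hne _ hv _ hy rfl
  · obtain ⟨w, hw, hw', -⟩ := hD u v u' v' h h' (fun he => by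
      rcases Sym2.eq_iff.1 he with ⟨he, -⟩ | ⟨he, -⟩
      · exact hne _ hu _ hu' he
      · exact hne _ hu _ hv' he) z ⟨hz, hz'⟩
    have hwX : w ∈ X := by rcases hw with rfl | rfl <;> assumption
    have hwY : w ∈ Y := by rcases hw' with rfl | rfl <;> assumption
    exact hne w hwX w hwY rfl

theorem im_nonneg_of_mem_inducedSupport (hpos : ∀ v, 0 ≤ (D.pos v).im)
    (harc : ∀ (u v : V) (h : G.Adj u v), T.Adj u v → ∀ t ∈ Set.Ioo (0 : unitInterval) 1,
      0 < (D.arc u v h t).im) {X : Set V} : ∀ z ∈ D.inducedSupport T X, 0 ≤ z.im := by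
  rintro z (⟨x, hx, rfl⟩ | ⟨u, hu, v, hv, h, hT, t, rfl⟩)
  · exact hpos x
  · rcases eq_or_ne t 0 with rfl | h0
    · rw [Path.source]; exact hpos u
    rcases eq_or_ne t 1 with rfl | h1
    · rw [Path.target]; exact hpos v
    exact (harc u v h hT t ⟨unitInterval.pos_iff_ne_zero.2 h0,
      unitInterval.lt_one_iff_ne_one.2 h1⟩).le

theorem joinedIn_inducedSupport_of_adj (hTG : T ≤ G) {X : Set V} {u v : V} (hu : u ∈ X)
    (hv : v ∈ X) (h : T.Adj u v) : JoinedIn (D.inducedSupport T X) (D.pos u) (D.pos v) :=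
  ⟨D.arc u v (hTG h), fun t => Or.inr ⟨u, hu, v, hv, hTG h, h, t, rfl⟩⟩

theorem joinedIn_inducedSupport_iterate (hTG : T ≤ G) {p : V → V} {X : Set V} {v : V} {n : ℕ}
    (hX : ∀ i ≤ n, p^[i] v ∈ X) (hp : ∀ i < n, T.Adj (p^[i] v) (p^[i + 1] v)) :
    JoinedIn (D.inducedSupport T X) (D.pos v) (D.pos (p^[n] v)) := by
  induction n with
  | zero => exact JoinedIn.refl (Or.inl ⟨v, hX 0 le_rfl, rfl⟩)
  | succ n ih =>
    exact (ih (fun i hi => hX i (by omega)) (fun i hi => hp i (by omega))).trans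
      (joinedIn_inducedSupport_of_adj hTG (hX n (by omega)) (hX (n + 1) le_rfl) (hp n (by omega)))

end GraphDrawing

/-- Disjoint sets in the closed upper half plane cannot join interleaved pairs of real points. -/
theorem not_cyclicallyOrdered_of_joinedIn {V : Type*} {f : V → ℂ} {F F' : Set ℂ}
    (hF : ∀ z ∈ F, 0 ≤ z.im) (hF' : ∀ z ∈ F', 0 ≤ z.im) (hd : Disjoint F F') {a a' b b' : V}
    (ha : (f a).im = 0) (ha' : (f a').im = 0) (hb : (f b).im = 0) (hb' : (f b').im = 0)
    (h : JoinedIn F (f a) (f a')) (h' : JoinedIn F' (f b) (f b')) :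
    ¬ CyclicallyOrdered (fun v => (f v).re) a b a' b' := by
  rw [Set.disjoint_iff_inter_eq_empty] at hd
  have hd' : F' ∩ F = ∅ := by rwa [Set.inter_comm]
  rintro (⟨h1, h2, h3⟩ | ⟨h1, h2, h3⟩ | ⟨h1, h2, h3⟩ | ⟨h1, h2, h3⟩)
  · exact (h.inter_nonempty_of_interleaved hF hF' ha ha' hb hb' h' h1 h2 h3).ne_empty hd
  · exact (h'.inter_nonempty_of_interleaved hF' hF hb hb' ha' ha h.symm h1 h2 h3).ne_empty hd'
  · exact (h.symm.inter_nonempty_of_interleaved hF hF' ha' ha hb' hb h'.symm h1 h2 h3).ne_empty hd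
  · exact (h'.symm.inter_nonempty_of_interleaved hF' hF hb' hb ha ha' h h1 h2 h3).ne_empty hd'

/-- Disjoint sets in the closed lower half plane cannot join interleaved pairs of real points. -/
theorem not_cyclicallyOrdered_of_joinedIn_lower {V : Type*} {f : V → ℂ} {F F' : Set ℂ}
    (hF : ∀ z ∈ F, z.im ≤ 0) (hF' : ∀ z ∈ F', z.im ≤ 0) (hd : Disjoint F F') {a a' b b' : V}
    (ha : (f a).im = 0) (ha' : (f a').im = 0) (hb : (f b).im = 0) (hb' : (f b').im = 0)
    (h : JoinedIn F (f a) (f a')) (h' : JoinedIn F' (f b) (f b')) :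
    ¬ CyclicallyOrdered (fun v => (f v).re) a b a' b' := by
  -- Complex conjugation reflects the configuration into the upper half plane.
  have hc := Complex.continuous_conj
  have := not_cyclicallyOrdered_of_joinedIn (f := fun v => starRingEnd ℂ (f v))
    (F := starRingEnd ℂ '' F) (F' := starRingEnd ℂ '' F') (a := a) (a' := a') (b := b) (b' := b')
    (by rintro _ ⟨z, hz, rfl⟩; simpa using hF z hz) (by rintro _ ⟨z, hz, rfl⟩; simpa using hF' z hz)
    ((Set.disjoint_image_iff (starRingEnd ℂ).injective).2 hd)
    (by simpa) (by simpa) (by simpa) (by simpa) (h.map hc) (h'.map hc)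
  simpa using this

/-- The leaves below `v` are not interleaved with the other leaves in a planar drawing above the
real line. -/
theorem not_cyclicallyOrdered_leavesBelow {V : Type*} [Fintype V] {G T : SimpleGraph V} {r : V}
    {D : GraphDrawing G} (hT : T.IsTree) (hTG : T ≤ G)
    (hleaf : ∀ v ∈ treeLeaves T r, T.dist r v = treeHeight T r) (hD : D.IsPlanar)
    (hzero : ∀ v ∈ treeLeaves T r, (D.pos v).im = 0) (hpos : ∀ v, 0 ≤ (D.pos v).im)
    (harc : ∀ (u v : V) (h : G.Adj u v), T.Adj u v → ∀ t ∈ Set.Ioo (0 : unitInterval) 1,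
      0 < (D.arc u v h t).im) {v a a' b b' : V}
    (ha : a ∈ (leveledTree hT hleaf).leavesBelow v) (ha' : a' ∈ (leveledTree hT hleaf).leavesBelow v)
    (hb : T.dist r b = treeHeight T r) (hb' : T.dist r b' = treeHeight T r)
    (hbv : b ∉ (leveledTree hT hleaf).leavesBelow v)
    (hbv' : b' ∉ (leveledTree hT hleaf).leavesBelow v) :
    ¬ CyclicallyOrdered (fun v => (D.pos v).re) a b a' b' := by
  set R := leveledTree hT hleaf with hR
  have hadj : ∀ q i, i < R.depth q → T.Adj (R.parent^[i] q) (R.parent^[i + 1] q) := by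
    intro q i hi
    rw [Function.iterate_succ_apply']
    have := R.depth_iterate_parent q i hi.le
    exact (mem_treeChildren_treeParent hT (r := r)
      (show R.depth (R.parent^[i] q) ≠ 0 by omega)).1.symm
  -- `X` consists of the descendants of `v`. The leaves in `X` are joined through `v` inside the
  -- drawing of `X`, the others through the root inside the drawing of the complement.
  set X : Set V := {w | R.depth v ≤ R.depth w ∧ R.parent^[R.depth w - R.depth v] w = v} with hX
  have hmem : ∀ q, R.depth q = R.height → ∀ i ≤ R.height, (R.parent^[i] q ∈ X ↔
      i ≤ R.height - R.depth v ∧ q ∈ R.leavesBelow v) := by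
    intro q hq i hi
    have hd := R.depth_iterate_parent q i (by omega)
    have hle := R.depth_le v
    have key : R.depth v ≤ R.depth (R.parent^[i] q) →
        R.parent^[R.depth (R.parent^[i] q) - R.depth v] (R.parent^[i] q) =
        R.parent^[R.height - R.depth v] q := by
      intro h
      rw [← Function.iterate_add_apply]
      congr 2; omega
    constructor
    · rintro ⟨h1, h2⟩
      exact ⟨by omega, hq, by rw [← key h1, h2]⟩
    · rintro ⟨h1, -, h2⟩
      have h3 : R.depth v ≤ R.depth (R.parent^[i] q) := by omega
      exact ⟨h3, by rw [key h3, h2]⟩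
  have hin : ∀ q ∈ R.leavesBelow v, JoinedIn (D.inducedSupport T X) (D.pos q) (D.pos v) := by
    intro q hq
    have := GraphDrawing.joinedIn_inducedSupport_iterate (D := D) hTG (p := R.parent) (X := X)
      (v := q) (n := R.height - R.depth v) (fun i hi => (hmem q hq.1 i (by omega)).2 ⟨hi, hq⟩)
      (fun i hi => hadj q i (by have := hq.1; omega))
    rwa [hq.2] at this
  have hout : ∀ q, R.depth q = R.height → q ∉ R.leavesBelow v →
      JoinedIn (D.inducedSupport T Xᶜ) (D.pos q) (D.pos r) := by
    intro q hq hqv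
    have := GraphDrawing.joinedIn_inducedSupport_iterate (D := D) hTG (p := R.parent) (X := Xᶜ)
      (v := q) (n := R.height) (fun i hi h => hqv ((hmem q hq i hi).1 h).2)
      (fun i hi => hadj q i (by omega))
    rwa [show R.parent^[R.height] q = r from R.eq_root _ (by
      have := R.depth_iterate_parent q R.height (by omega)
      omega)] at this
  have hz : ∀ q, R.depth q = R.height → (D.pos q).im = 0 :=
    fun q hq => hzero q (mem_treeLeaves_of_dist_eq hq)
  exact not_cyclicallyOrdered_of_joinedIn
    (GraphDrawing.im_nonneg_of_mem_inducedSupport hpos harc)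
    (GraphDrawing.im_nonneg_of_mem_inducedSupport hpos harc)
    (GraphDrawing.disjoint_inducedSupport hD disjoint_compl_right) (hz a ha.1) (hz a' ha'.1)
    (hz b hb) (hz b' hb') ((hin a ha).trans (hin a' ha').symm)
    ((hout b hb hbv).trans (hout b' hb' hbv').symm)

/-- Two edges drawn below the real line with ends on this line are not interleaved. -/
theorem not_cyclicallyOrdered_arcs {V : Type*} {G : SimpleGraph V} {D : GraphDrawing G}
    (hD : D.IsPlanar) {a a' b b' : V} (h : G.Adj a a') (h' : G.Adj b b')
    (ha : (D.pos a).im = 0) (ha' : (D.pos a').im = 0) (hb : (D.pos b).im = 0)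
    (hb' : (D.pos b').im = 0) (harc : ∀ t ∈ Set.Ioo (0 : unitInterval) 1, (D.arc a a' h t).im < 0)
    (harc' : ∀ t ∈ Set.Ioo (0 : unitInterval) 1, (D.arc b b' h' t).im < 0) :
    ¬ CyclicallyOrdered (fun v => (D.pos v).re) a b a' b' := by
  have key : ∀ {a a' : V} (h : G.Adj a a'), (D.pos a).im = 0 → (D.pos a').im = 0 →
      (∀ t ∈ Set.Ioo (0 : unitInterval) 1, (D.arc a a' h t).im < 0) →
      ∀ z ∈ Set.range (D.arc a a' h), z.im ≤ 0 := by
    rintro a a' h ha ha' harc _ ⟨t, rfl⟩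
    rcases eq_or_ne t 0 with rfl | h0
    · rw [Path.source, ha]
    rcases eq_or_ne t 1 with rfl | h1
    · rw [Path.target, ha']
    exact (harc t ⟨unitInterval.pos_iff_ne_zero.2 h0, unitInterval.lt_one_iff_ne_one.2 h1⟩).le
  intro hcyc
  have hne : a ≠ b ∧ a ≠ b' ∧ a' ≠ b ∧ a' ≠ b' := by
    refine ⟨?_, ?_, ?_, ?_⟩ <;> rintro rfl <;>
      rcases hcyc with ⟨h1, h2, h3⟩ | ⟨h1, h2, h3⟩ | ⟨h1, h2, h3⟩ | ⟨h1, h2, h3⟩ <;> linarith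
  refine not_cyclicallyOrdered_of_joinedIn_lower (key h ha ha' harc) (key h' hb hb' harc') ?_
    ha ha' hb hb' ⟨D.arc a a' h, fun t => ⟨t, rfl⟩⟩ ⟨D.arc b b' h', fun t => ⟨t, rfl⟩⟩ hcyc
  rw [Set.disjoint_left]
  intro z hz hz'
  obtain ⟨w, hw, hw', -⟩ := hD a a' b b' h h' (fun he => by
    rcases Sym2.eq_iff.1 he with ⟨he, -⟩ | ⟨he, -⟩
    · exact hne.1 he
    · exact hne.2.1 he) z ⟨hz, hz'⟩
  rcases hw with rfl | rfl <;> rcases hw' with rfl | rfl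
  · exact hne.1 rfl
  · exact hne.2.1 rfl
  · exact hne.2.2.1 rfl
  · exact hne.2.2.2 rfl

/-! ### The bound for matched graphs -/

theorem lemma3 {V : Type*} [Fintype V] (Δ : ℕ) (G : SimpleGraph V)
    (hG : IsMatchedGraph Δ G) : queueNumber G ≤ ((2 * Δ - 2 : ℕ) : ℕ∞) := by
  obtain ⟨T, r, M, D, ⟨hT, hary⟩, hM, hMverts, hTM, hD, hzero, harcT, harcM, -, hlayer⟩ := hG
  have hTG : T ≤ G := hTM ▸ le_sup_left
  -- A leaf in a positive layer would lie both on L and strictly above it.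
  have hleaf : ∀ v ∈ treeLeaves T r, T.dist r v = treeHeight T r := by
    intro v hv
    have h1 := dist_le_treeHeight (T := T) (r := r) v
    by_contra h2
    have h3 : 0 < treeLayer T r v := by unfold treeLayer; omega
    have h4 := hlayer v h3
    rw [hzero v hv] at h4
    exact h3.ne (by exact_mod_cast h4)
  have hpos : ∀ v, 0 ≤ (D.pos v).im := by
    intro v
    rcases (treeLayer T r v).eq_zero_or_pos with h | h
    · have h1 := dist_le_treeHeight (T := T) (r := r) v
      unfold treeLayer at h
      rw [hzero v (mem_treeLeaves_of_dist_eq (by omega))]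
    · rw [hlayer v h]
      positivity
  set R := leveledTree hT hleaf with hR
  have hMex : ∀ q, R.depth q = R.height → ∃ w, M.Adj q w := fun q hq =>
    (hM (hMverts ▸ mem_treeLeaves_of_dist_eq hq)).exists
  have hMdepth : ∀ {u v}, M.Adj u v → R.depth v = R.height := fun h =>
    hleaf _ (hMverts ▸ M.edge_vert h.symm)
  classical
  let m : V → V := fun q => if h : ∃ w, M.Adj q w then h.choose else q
  have hm : ∀ q, R.depth q = R.height → M.Adj q (m q) := by
    intro q hq
    have h := hMex q hq
    simp only [m, dif_pos h]
    exact h.choose_spec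
  have hm_eq : ∀ {u v}, M.Adj u v → v = m u := fun h =>
    hM.eq_of_adj_left h (hm _ (hMdepth h.symm))
  have hz : ∀ q, R.depth q = R.height → (D.pos q).im = 0 :=
    fun q hq => hzero q (mem_treeLeaves_of_dist_eq hq)
  obtain ⟨y, hy, hconn, hcyc⟩ := R.exists_rotation_ordConnected (fun v => (D.pos v).re)
    (fun a ha b hb hab => D.pos_injective (Complex.ext hab (by rw [hz a ha, hz b hb])))
    (fun v a ha a' ha' b b' hb hb' hbv hbv' =>
      not_cyclicallyOrdered_leavesBelow hT hTG hleaf hD hzero hpos harcT ha ha' hb hb' hbv hbv')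
  have hNM : R.NoncrossingMatching y m :=
    { injOn := hy
      ordConnected := hconn
      depth_partner := fun q hq => hMdepth (hm q hq)
      partner_partner := fun q hq => (hm_eq (hm q hq).symm).symm
      noncrossing := fun a b ha hb h =>
        not_cyclicallyOrdered_arcs hD (hm a ha).adj_sub (hm b hb).adj_sub (hz a ha)
          (hz _ (hMdepth (hm a ha))) (hz b hb) (hz _ (hMdepth (hm b hb)))
          (harcM _ _ _ (hm a ha)) (harcM _ _ _ (hm b hb)) (hcyc _ _ _ _ (Or.inl h)) }
  have hchild : ∀ v, {c | R.depth c = R.depth v + 1 ∧ R.parent c = v} ⊆ treeChildren T r v := by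
    rintro v c ⟨hc, rfl⟩
    exact mem_treeChildren_treeParent hT (show R.depth c ≠ 0 by omega)
  have hcard : ∀ v, {c | R.depth c = R.depth v + 1 ∧ R.parent c = v}.ncard ≤ Δ - 1 := fun v =>
    (Set.ncard_le_ncard (hchild v) (Set.toFinite _)).trans (ENat.toNat_le_of_le_natCast (hary v))
  -- If the root were a leaf, it would be the only vertex available as its own partner.
  have hheight : R.depth R.root < R.height := by
    rw [R.depth_root]
    by_contra! h
    have h0 : R.depth R.root = R.height := by rw [R.depth_root]; omega
    have h1 := hm _ h0
    have h2 : m R.root = R.root := R.eq_root _ (by rw [hMdepth h1]; omega)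
    exact h1.ne h2.symm
  have hpos' : 0 < Δ - 1 := by
    obtain ⟨c, hc⟩ := R.exists_child R.root hheight
    refine lt_of_lt_of_le ?_ (hcard R.root)
    exact (Set.ncard_pos (Set.toFinite _)).2 ⟨c, hc⟩
  have hlay : Nonempty (QueueLayout G (2 * (Δ - 1))) := by
    refine R.nonempty_queueLayout hpos' hcard hNM fun u v huv => ?_
    rw [hTM, SimpleGraph.sup_adj, SimpleGraph.Subgraph.spanningCoe_adj] at huv
    rcases huv with huv | huv
    · rcases hT.dist_eq_dist_add_one_of_adj r huv with h | h
      · exact Or.inr (Or.inl ⟨h, treeParent_eq hT ⟨huv.symm, h⟩⟩)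
      · exact Or.inl ⟨h, treeParent_eq hT ⟨huv, h⟩⟩
    · exact Or.inr (Or.inr ⟨hMdepth huv.symm, hMdepth huv, hm_eq huv⟩)
  rw [show 2 * Δ - 2 = 2 * (Δ - 1) by omega]
  exact iInf₂_le (f := fun (k : ℕ) (_ : Nonempty (QueueLayout G k)) => (k : ℕ∞)) _ hlay
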